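/- Let $d\in\mathbb N$, $1\le p\le\infty$, let $M,K\subset\mathbb R^d$ with $K$ compact, let $Y\subset\mathbb Z^+$ be finite, and let $f:M\to Y$ be non-constant. Put $\overline Y=Y\cup\{-1\}$ and $q=|\overline Y|$, and let $\overline f:\mathbb R^d\to\overline Y$ be the extension of $f$ with $\overline f(x)=-1$ for $x\notin M$. Let $$h(x)=\inf\{\|x-z\|_p : z\in\mathbb R^d,\ \overline f(z)\ne\overline f(x)\}$$ be the $\ell^p$-distance of $x$ to the decision boundary, and for $\varepsilon>0$ let $M_\varepsilon=\{x\in M : h(x)>\varepsilon\}$. Let $p_q:\mathbb R^q\to\{1,\dots,q\}$, $p_q(v)=\min\{i : v_i\ge v_j \text{ for all } j\}$, be the class prediction function, and let $\sigma:\overline Y\to\{1,\dots,q\}$ be any bijection, which numbers the labels by the output coordinates (if $Y\subset\{1,\dots,q\}$, one may take $\sigma(y)=y$ for $y\in Y$). For $\rho:\mathbb R\to\mathbb R$, a neural network with activation $\rho$ and hidden layer sizes $N_1,\dots,N_{L-1}$ is a map $\mathbb R^d\to\mathbb R^q$ of the form $W_L\circ\rho\circ W_{L-1}\circ\cdots\circ\rho\circ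 W_1$ with affine maps $W_l:\mathbb R^{N_{l-1}}\to\mathbb R^{N_l}$, $N_0=d$, $N_L=q$, where $\rho$ acts coordinatewise. It is shallow if it has exactly one hidden layer ($L=2$, with $N_1$ arbitrary), and its width is $\max_{1\le l\le L-1}N_l$. Let $\rho$ be continuous and not a polynomial, and assume that there is a point $a$ such that $\rho$ is differentiable in a neighbourhood of $a$, $\rho'$ is continuous at $a$ and $\rho'(a)\neq0$. Then for every $\varepsilon>0$: 1. there is a shallow neural network $\Psi_1:\mathbb R^d\to\mathbb R^q$ with activation $\rho$ such that $p_q(\Psi_1(x))=\sigma(f(x))$ for all $x\in M_\varepsilon\cap K$; 2. there is a neural network $\Psi_2:\mathbb R^d\to\mathbb R^q$ with activation $\rho$, of width $d+q+2$ (and some finite depth), such that $p_q(\Psi_2(x))=\sigma(f(x))$ for all $x\in M_\varepsilon\cap K$. -/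

import Mathlib

open scoped ENNReal

noncomputable section

/-- The extended label set `Y ∪ {-1}`. -/
def extLabels (Y : Finset ℤ) : Finset ℤ := insert (-1) Y

open Classical in
/-- The extension of a classification function `f : M → Y` to all of `ℝ^d`,
with value `-1` off `M`. -/
def labelExtension {d : ℕ} {M : Set (Fin d → ℝ)} {Y : Finset ℤ} (f : M → Y)
    (x : Fin d → ℝ) : ℤ :=
  if hx : x ∈ M then (f ⟨x, hx⟩ : ℤ) else -1

/-- The `ℓ^p`-distance of `x` to the decision boundary of `g`:
the infimum of `‖x - z‖_p` over all `z` with `g x ≠ g z`. -/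
def boundaryDist {d : ℕ} (p : ℝ≥0∞) (g : (Fin d → ℝ) → ℤ) (x : Fin d → ℝ) : ℝ :=
  sInf {r : ℝ | ∃ z : Fin d → ℝ, g x ≠ g z ∧ r = ‖WithLp.toLp p (x - z)‖}

/-- The `ε`-stable set: the points of `M` whose distance to the decision boundary of the
extension of `f` exceeds `ε`. -/
def stableSet {d : ℕ} {M : Set (Fin d → ℝ)} {Y : Finset ℤ} (p : ℝ≥0∞) (f : M → Y)
    (ε : ℝ) : Set (Fin d → ℝ) :=
  {x | x ∈ M ∧ ε < boundaryDist p (labelExtension f) x}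

/-- The class prediction function: the least (one-based) index of a maximal coordinate. -/
def classPrediction {n : ℕ} (v : Fin n → ℝ) : ℕ :=
  sInf {i : ℕ | ∃ k : Fin n, i = (k : ℕ) + 1 ∧ ∀ j : Fin n, v j ≤ v k}

/-- `neuralNetworks ρ m d [N₁, …, N_{L-1}]` is the set of all maps `ℝ^d → ℝ^m` of the form
`W_L ∘ ρ ∘ W_{L-1} ∘ ⋯ ∘ ρ ∘ W₁`, where `W_l` is affine from `ℝ^{N_{l-1}}` to `ℝ^{N_l}`
(with `N₀ = d`, `N_L = m`) and `ρ` acts on each coordinate. -/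
def neuralNetworks (ρ : ℝ → ℝ) (m : ℕ) :
    (d : ℕ) → List ℕ → Set ((Fin d → ℝ) → (Fin m → ℝ))
  | d, [] => {φ | ∃ W : (Fin d → ℝ) →ᵃ[ℝ] (Fin m → ℝ), φ = fun x => W x}
  | d, N :: Ns => {φ | ∃ W : (Fin d → ℝ) →ᵃ[ℝ] (Fin N → ℝ),
      ∃ ψ ∈ neuralNetworks ρ m N Ns, φ = fun x => ψ (fun i => ρ (W x i))}

/-- Shallow networks: exactly one hidden layer, of arbitrary finite width. -/
def shallowNetworks (ρ : ℝ → ℝ) (d m : ℕ) : Set ((Fin d → ℝ) → (Fin m → ℝ)) :=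
  {φ | ∃ N : ℕ, φ ∈ neuralNetworks ρ m d [N]}

/-- Networks of arbitrary depth whose width, that is, the maximum of the hidden layer sizes,
is `w`. -/
def networksOfWidth (ρ : ℝ → ℝ) (d m w : ℕ) : Set ((Fin d → ℝ) → (Fin m → ℝ)) :=
  {φ | ∃ Ns : List ℕ, IsGreatest {N | N ∈ Ns} w ∧ φ ∈ neuralNetworks ρ m d Ns}

/-- `ρ` is given by a polynomial. -/
def IsPolynomialFun (ρ : ℝ → ℝ) : Prop :=
  ∃ P : Polynomial ℝ, ∀ x, ρ x = P.eval x

/-- `ρ` is continuously differentiable at `a`: it is differentiable near `a`, and its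
derivative is continuous at `a`. -/
def ContinuouslyDifferentiableAt (ρ : ℝ → ℝ) (a : ℝ) : Prop :=
  (∀ᶠ x in nhds a, DifferentiableAt ℝ ρ x) ∧ ContinuousAt (deriv ρ) a

end

/-! The distance from `x` to the set of points not labelled `j`, taken for each `j`, is a continuous
score. On the stable set it vanishes in every wrong coordinate and is at least some fixed `δ > 0` in
the right one (`exists_score`), so any network uniformly within `δ / 2` of it on `K` classifies
correctly.

Shallow networks get that close by universal approximation (`eq_top_of_superpose_mem`): as `ρ` is
not a polynomial, the closed span of its ridge functions contains all powers of affine functions,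
hence their exponentials, and Stone–Weierstrass applies. A deep narrow network then evaluates the
same finite sum of ridge functions one term per layer, carrying the input and the partial sums along
by approximating the identity with `ρ` near `a` (`deepApproximable_registerSum`). -/

/-! ### Polynomial functions on the line. -/

open Filter Topology MeasureTheory in
theorem exists_coeff_of_iteratedDeriv_eq_zero (k : ℕ) (g : ℝ → ℝ) (hg : ContDiff ℝ (⊤ : ℕ∞) g)
    (h : ∀ x, iteratedDeriv k g x = 0) :
    ∃ c : ℕ → ℝ, ∀ x, g x = ∑ i ∈ Finset.range k, c i * x ^ i := by
  induction k generalizing g with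
  | zero => exact ⟨0, fun x => by simpa using h x⟩
  | succ k ih =>
    obtain ⟨c, hc⟩ := ih (deriv g) ((contDiff_infty_iff_deriv.1 hg).2)
      (fun x => by rw [← iteratedDeriv_succ']; exact h x)
    have hgd : Differentiable ℝ g := (contDiff_infty_iff_deriv.1 hg).1
    set G : ℝ → ℝ := fun x => ∑ i ∈ Finset.range k, c i / (i + 1) * x ^ (i + 1) with hG
    have hGd : ∀ x, HasDerivAt G (deriv g x) x := by
      intro x
      rw [hc x]
      refine HasDerivAt.fun_sum fun i _ => ?_
      have := (hasDerivAt_pow (i + 1) x).const_mul (c i / ((i : ℝ) + 1))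
      refine this.congr_deriv ?_
      have : (i : ℝ) + 1 ≠ 0 := by positivity
      push_cast
      rw [← mul_assoc, div_mul_cancel₀ _ this]
    have hconst : ∀ x, g x - G x = g 0 - G 0 := by
      intro x
      refine is_const_of_deriv_eq_zero (f := fun x => g x - G x)
        (fun x => ((hgd x).hasDerivAt.sub (hGd x)).differentiableAt) (fun x => ?_) x 0
      exact ((hgd x).hasDerivAt.sub (hGd x)).deriv.trans (sub_self _)
    refine ⟨fun i => if i = 0 then g 0 - G 0 else c (i - 1) / ((i - 1 : ℕ) + 1), fun x => ?_⟩
    rw [Finset.sum_range_succ']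
    have := hconst x
    simp only [hG] at this ⊢
    simp at this ⊢
    linarith

open Filter Topology in
/-- Pointwise limits of polynomial functions of bounded degree are polynomial functions. -/
theorem isPolynomialFun_of_tendsto {k : ℕ} {g : ℕ → ℝ → ℝ} {ρ : ℝ → ℝ}
    (hg : ∀ n, ∃ c : ℕ → ℝ, ∀ x, g n x = ∑ i ∈ Finset.range k, c i * x ^ i)
    (hlim : ∀ x, Tendsto (fun n => g n x) atTop (𝓝 (ρ x))) : IsPolynomialFun ρ := by
  classical
  have hinj : Set.InjOn (fun i : ℕ => (i : ℝ)) (Finset.range k : Set ℕ) :=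
    fun i _ j _ h => Nat.cast_injective h
  -- Lagrange interpolation at `0, …, k - 1` recovers `g n` from `k` of its values, and these
  -- converge.
  have hrep : ∀ n x, g n x = ∑ i ∈ Finset.range k,
      g n i * (Lagrange.basis (Finset.range k) (fun i : ℕ => (i : ℝ)) i).eval x := by
    intro n x
    obtain ⟨c, hc⟩ := hg n
    set P : Polynomial ℝ := ∑ i ∈ Finset.range k, Polynomial.C (c i) * Polynomial.X ^ i with hP
    have hPe : ∀ x, P.eval x = g n x := by
      intro x; rw [hc x, hP, Polynomial.eval_finsetSum]; simp
    have hdeg : P.degree < (Finset.range k).card := by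
      rw [Finset.card_range]
      refine (Polynomial.degree_sum_le _ _).trans_lt ?_
      refine (Finset.sup_lt_iff (WithBot.bot_lt_coe k)).2 ?_
      intro i hi
      exact (Polynomial.degree_C_mul_X_pow_le _ _).trans_lt
        (WithBot.coe_lt_coe.2 (Finset.mem_range.1 hi))
    have := Lagrange.eq_interpolate hinj hdeg
    rw [← hPe x, this, Lagrange.interpolate_apply, Polynomial.eval_finsetSum]
    refine Finset.sum_congr rfl fun i _ => ?_
    rw [Polynomial.eval_mul, Polynomial.eval_C, hPe]
  refine ⟨∑ i ∈ Finset.range k, Polynomial.C (ρ i) *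
    Lagrange.basis (Finset.range k) (fun i : ℕ => (i : ℝ)) i, fun x => ?_⟩
  refine tendsto_nhds_unique (hlim x) ?_
  rw [Polynomial.eval_finsetSum]
  refine Tendsto.congr (fun n => (hrep n x).symm) ?_
  refine tendsto_finsetSum _ fun i _ => ?_
  rw [Polynomial.eval_mul, Polynomial.eval_C]
  exact (hlim i).mul_const _

/-! ### Universal approximation in `C(X, ℝ)`. -/

section Closure

open Filter Topology MeasureTheory

variable {X : Type*} [TopologicalSpace X] [CompactSpace X]

/-- The superposition of a continuous function on the line with a continuous function. -/
def superpose (g : ℝ → ℝ) (hg : Continuous g) (u : C(X, ℝ)) : C(X, ℝ) :=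
  ContinuousMap.comp ⟨g, hg⟩ u

omit [CompactSpace X] in
@[simp] theorem superpose_apply (g : ℝ → ℝ) (hg : Continuous g) (u : C(X, ℝ)) (x : X) :
    superpose g hg u x = g (u x) := rfl

omit [CompactSpace X] in
theorem continuous_superpose (g : ℝ → ℝ) (hg : Continuous g) :
    Continuous (superpose (X := X) g hg) :=
  ContinuousMap.continuous_postcomp _

theorem Submodule.integral_mem_of_isClosed {α E : Type*} [MeasurableSpace α] {μ : Measure α}
    [NormedAddCommGroup E] [NormedSpace ℝ E] [CompleteSpace E]
    (V : Submodule ℝ E) (hV : IsClosed (V : Set E)) {F : α → E} (hF : Integrable F μ)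
    (h : ∀ a, F a ∈ V) : ∫ a, F a ∂μ ∈ V := by
  by_contra hn
  obtain ⟨ℓ, hℓ, h1⟩ : ∃ ℓ : StrongDual ℝ E, (∀ v ∈ V, ℓ v = 0) ∧ ℓ (∫ a, F a ∂μ) ≠ 0 := by
    obtain ⟨ℓ, s, h1, h2⟩ := geometric_hahn_banach_closed_point V.convex hV hn
    have hs : 0 < s := by simpa using h1 0 V.zero_mem
    refine ⟨ℓ, fun v hv => ?_, (hs.trans h2).ne'⟩
    -- A functional bounded above on a subspace vanishes there: otherwise a multiple of `v` attains
    -- the value `s`.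
    by_contra hv0
    have := h1 ((s / ℓ v) • v) (V.smul_mem _ hv)
    rw [map_smul, smul_eq_mul, div_mul_cancel₀ _ hv0] at this
    exact lt_irrefl _ this
  apply h1
  rw [← ℓ.integral_comp_comm hF]
  simp [hℓ _ (h _)]

theorem superpose_convolution_mem (V : Submodule ℝ C(X, ℝ)) (hV : IsClosed (V : Set C(X, ℝ)))
    {ρ φ : ℝ → ℝ} (hρ : Continuous ρ) (hφ : Continuous φ) (hφc : HasCompactSupport φ)
    (u : C(X, ℝ)) (h : ∀ t : ℝ, superpose ρ hρ (u - ContinuousMap.const X t) ∈ V)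
    (hc : Continuous (convolution φ ρ (ContinuousLinearMap.lsmul ℝ ℝ) volume)) :
    superpose (convolution φ ρ (ContinuousLinearMap.lsmul ℝ ℝ) volume) hc u ∈ V := by
  set F : ℝ → C(X, ℝ) := fun t => φ t • superpose ρ hρ (u - ContinuousMap.const X t) with hF
  have hFc : Continuous F := by
    refine hφ.smul ((continuous_superpose ρ hρ).comp (continuous_const.sub ?_))
    exact ContinuousMap.continuous_const'
  have hFi : Integrable F := by
    refine hFc.integrable_of_hasCompactSupport ?_
    exact hφc.smul_right
  have : superpose (convolution φ ρ (ContinuousLinearMap.lsmul ℝ ℝ) volume) hc u = ∫ t, F t := by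
    ext x
    rw [ContinuousMap.integral_apply hFi]
    simp [hF, convolution_def]
  rw [this]
  exact V.integral_mem_of_isClosed hV hFi fun t => V.smul_mem _ (h t)

/-- The derivative is in the sup norm. Writing the increment as a `C(X, ℝ)`-valued integral of a
continuous function replaces uniform estimates by the fundamental theorem of calculus. -/
theorem hasDerivAt_superpose_line {g g' : ℝ → ℝ} (hg : Continuous g) (hg' : Continuous g')
    (hd : ∀ y, HasDerivAt g (g' y) y) (u v : C(X, ℝ)) :
    HasDerivAt (fun s : ℝ => superpose g hg (v + s • u)) (superpose g' hg' v * u) 0 := by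
  set F : ℝ → C(X, ℝ) := fun s => superpose g' hg' (v + s • u) * u with hF
  have hFc : Continuous F :=
    ((continuous_superpose g' hg').comp (by fun_prop)).mul continuous_const
  have hint : ∀ s : ℝ, superpose g hg (v + s • u) = superpose g hg v + ∫ t in (0 : ℝ)..s, F t := by
    intro s
    ext x
    have h1 : (∫ t in (0 : ℝ)..s, F t) x = ∫ t in (0 : ℝ)..s, F t x :=
      ((ContinuousMap.evalCLM ℝ x).intervalIntegral_comp_comm (hFc.intervalIntegrable _ _)).symm
    have h2 : ∫ t in (0 : ℝ)..s, F t x = g (v x + s * u x) - g (v x + 0 * u x) := by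
      refine intervalIntegral.integral_eq_sub_of_hasDerivAt (f := fun t => g (v x + t * u x))
        (fun t _ => ?_) ?_
      · have : HasDerivAt (fun t : ℝ => v x + t * u x) (u x) t := by
          simpa using ((hasDerivAt_id t).mul_const (u x)).const_add (v x)
        exact (hd _).comp t this
      · exact ((ContinuousMap.evalCLM ℝ x).continuous.comp hFc).intervalIntegrable _ _
    simp only [ContinuousMap.add_apply, superpose_apply, h1, h2, ContinuousMap.smul_apply,
      smul_eq_mul]
    ring_nf
  simp_rw [hint]
  have := (intervalIntegral.integral_hasDerivAt_right (hFc.intervalIntegrable 0 0)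
    hFc.stronglyMeasurable.stronglyMeasurableAtFilter hFc.continuousAt).const_add
      (superpose g hg v)
  exact this.congr_deriv (by simp [hF])

theorem Submodule.hasDerivAt_mem_of_isClosed {E : Type*} [NormedAddCommGroup E] [NormedSpace ℝ E]
    (V : Submodule ℝ E) (hV : IsClosed (V : Set E)) {F : ℝ → E} {F' : E} {s : ℝ}
    (hF : HasDerivAt F F' s) (h : ∀ s, F s ∈ V) : F' ∈ V := by
  refine hV.mem_of_tendsto hF.tendsto_slope (Eventually.of_forall fun t => ?_)
  rw [slope_def_module]
  exact V.smul_mem _ (V.sub_mem (h _) (h _))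

/-- Each differentiation of `s ↦ g (v + s • u)` brings down a factor `u`, and difference quotients
stay in the closed space `V`. -/
theorem superpose_iteratedDeriv_mul_pow_mem (V : Submodule ℝ C(X, ℝ))
    (hV : IsClosed (V : Set C(X, ℝ))) (U : Submodule ℝ C(X, ℝ))
    {g : ℝ → ℝ} (hg : ContDiff ℝ (⊤ : ℕ∞) g) (h : ∀ u ∈ U, superpose g hg.continuous u ∈ V)
    (k : ℕ) (u v : C(X, ℝ)) (hu : u ∈ U) (hv : v ∈ U) :
    superpose (iteratedDeriv k g) (hg.continuous_iteratedDeriv k (by exact_mod_cast le_top)) v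
      * u ^ k ∈ V := by
  induction k generalizing v with
  | zero =>
    convert h v hv using 1
    ext x; simp
  | succ k ih =>
    have hd : ∀ y, HasDerivAt (iteratedDeriv k g) (iteratedDeriv (k + 1) g y) y := fun y => by
      rw [iteratedDeriv_succ]
      exact ((hg.differentiable_iteratedDeriv k (by exact_mod_cast ENat.natCast_lt_top k)) y).hasDerivAt
    have := (hasDerivAt_superpose_line
      (hg.continuous_iteratedDeriv k (by exact_mod_cast le_top))
      (hg.continuous_iteratedDeriv (k + 1) (by exact_mod_cast le_top)) hd u v).mul_const (u ^ k)
    have := V.hasDerivAt_mem_of_isClosed hV this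
      fun s => ih _ (U.add_mem hv (U.smul_mem s hu))
    rwa [mul_assoc, ← pow_succ'] at this

/-- Mollifications of `ρ` are smooth and still superpose into `V`. Differentiating one `k` times
along `u` at a constant `b` puts its `k`-th derivative at `b`, times `u ^ k`, in `V`. If `u ^ k ∉
V`, all these derivatives vanish, so the mollifications are polynomials of degree below `k`, and so
is their limit `ρ`. -/
theorem pow_mem_of_superpose_mem (V : Submodule ℝ C(X, ℝ))
    (hV : IsClosed (V : Set C(X, ℝ))) (U : Submodule ℝ C(X, ℝ)) (hU : 1 ∈ U)
    {ρ : ℝ → ℝ} (hρ : Continuous ρ) (hpoly : ¬ IsPolynomialFun ρ)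
    (h : ∀ u ∈ U, superpose ρ hρ u ∈ V) (k : ℕ) (u : C(X, ℝ)) (hu : u ∈ U) : u ^ k ∈ V := by
  have hconst : ∀ t : ℝ, ContinuousMap.const X t ∈ U := fun t => by
    convert U.smul_mem t hU using 1
    ext x; simp
  by_contra hn
  apply hpoly
  let φ : ℕ → ContDiffBump (0 : ℝ) := fun n =>
    ⟨1 / (n + 1 : ℝ) / 2, 1 / (n + 1 : ℝ), by positivity, half_lt_self (by positivity)⟩
  have hφ : Tendsto (fun n => (φ n).rOut) atTop (𝓝 0) := tendsto_one_div_add_atTop_nhds_zero_nat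
  refine isPolynomialFun_of_tendsto (k := k)
    (g := fun n => convolution ((φ n).normed volume) ρ (ContinuousLinearMap.lsmul ℝ ℝ) volume)
    (fun n => ?_) (fun x => ContDiffBump.convolution_tendsto_right_of_continuous hφ hρ x)
  have hsm : ContDiff ℝ (⊤ : ℕ∞)
      (convolution ((φ n).normed volume) ρ (ContinuousLinearMap.lsmul ℝ ℝ) volume) :=
    (φ n).hasCompactSupport_normed.contDiff_convolution_left _ (φ n).contDiff_normed
      hρ.locallyIntegrable
  refine exists_coeff_of_iteratedDeriv_eq_zero k _ hsm fun b => ?_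
  by_contra hb
  apply hn
  have := superpose_iteratedDeriv_mul_pow_mem V hV U hsm (fun u hu =>
    superpose_convolution_mem V hV hρ (φ n).continuous_normed (φ n).hasCompactSupport_normed u
      (fun t => h _ (U.sub_mem hu (hconst t))) _) k u _ hu (hconst b)
  rw [← V.smul_mem_iff hb]
  convert this using 1
  ext x; simp

/-- The universal approximation theorem: a closed space of continuous functions on a compact space
that contains all superpositions of a non-polynomial function with a space of functions that
separates points and contains the constants is everything. -/
theorem eq_top_of_superpose_mem (V : Submodule ℝ C(X, ℝ))
    (hV : IsClosed (V : Set C(X, ℝ))) (U : Submodule ℝ C(X, ℝ)) (hU : 1 ∈ U)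
    (hsep : ∀ x y : X, x ≠ y → ∃ u ∈ U, u x ≠ u y)
    {ρ : ℝ → ℝ} (hρ : Continuous ρ) (hpoly : ¬ IsPolynomialFun ρ)
    (h : ∀ u ∈ U, superpose ρ hρ u ∈ V) : V = ⊤ := by
  have hexp : ∀ u ∈ U, NormedSpace.exp u ∈ V := fun u hu =>
    hV.mem_of_tendsto (NormedSpace.exp_series_hasSum_exp' (𝕂 := ℝ) u) (Eventually.of_forall
      fun s => V.sum_mem fun n _ =>
        V.smul_mem _ (pow_mem_of_superpose_mem V hV U hU hρ hpoly h n u hu))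
  -- Exponentials are closed under multiplication, so their linear span is already an algebra.
  let S : Submonoid C(X, ℝ) :=
    { carrier := {g | ∃ u ∈ U, g = NormedSpace.exp u}
      one_mem' := ⟨0, U.zero_mem, NormedSpace.exp_zero.symm⟩
      mul_mem' := by
        rintro _ _ ⟨u, hu, rfl⟩ ⟨v, hv, rfl⟩
        exact ⟨u + v, U.add_mem hu hv, NormedSpace.exp_add.symm⟩ }
  have hA : (Subalgebra.toSubmodule (Algebra.adjoin ℝ (S : Set C(X, ℝ)))) ≤ V := by
    rw [Algebra.adjoin_eq_span, Submonoid.closure_eq, Submodule.span_le]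
    rintro _ ⟨u, hu, rfl⟩
    exact hexp u hu
  have hev : ∀ (u : C(X, ℝ)) (x : X), NormedSpace.exp u x = Real.exp (u x) := by
    intro u x
    have h1 := (NormedSpace.exp_series_hasSum_exp' (𝕂 := ℝ) u).mapL (ContinuousMap.evalCLM ℝ x)
    have h2 := NormedSpace.exp_series_hasSum_exp' (𝕂 := ℝ) (u x)
    rw [← Real.exp_eq_exp_ℝ] at h2
    exact h1.unique (by simpa using h2)
  have hs : (Algebra.adjoin ℝ (S : Set C(X, ℝ))).SeparatesPoints := by
    intro x y hxy
    obtain ⟨u, hu, hne⟩ := hsep x y hxy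
    refine ⟨_, ⟨NormedSpace.exp u, Algebra.subset_adjoin ⟨u, hu, rfl⟩, rfl⟩, ?_⟩
    change NormedSpace.exp u x ≠ NormedSpace.exp u y
    rw [hev, hev]
    exact fun h => hne (Real.exp_injective h)
  rw [eq_top_iff]
  intro g _
  have := ContinuousMap.continuousMap_mem_subalgebra_closure_of_separatesPoints _ hs g
  exact closure_minimal hA hV this

end Closure

/-! ### Ridge functions and shallow networks. -/

/-- The space of linear combinations of functions `x ↦ ρ (A x)` with `A` affine, with vector
coefficients. -/
def ridgeSpan (ρ : ℝ → ℝ) (d m : ℕ) : Submodule ℝ ((Fin d → ℝ) → (Fin m → ℝ)) :=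
  Submodule.span ℝ {φ | ∃ (A : (Fin d → ℝ) →ᵃ[ℝ] ℝ) (c : Fin m → ℝ), φ = fun x => ρ (A x) • c}

theorem exists_sum_of_mem_ridgeSpan {ρ : ℝ → ℝ} {d m : ℕ} {h : (Fin d → ℝ) → (Fin m → ℝ)}
    (hh : h ∈ ridgeSpan ρ d m) :
    ∃ (n : ℕ) (A : Fin n → (Fin d → ℝ) →ᵃ[ℝ] ℝ) (c : Fin n → Fin m → ℝ),
      h = fun x => ∑ i, ρ (A i x) • c i := by
  obtain ⟨n, r, g, rfl⟩ := Submodule.mem_span_set'.1 hh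
  choose A c hg using fun i => (g i).2
  refine ⟨n, A, fun i => r i • c i, ?_⟩
  ext x j
  simp [hg, Finset.sum_apply, mul_left_comm]

/-- The restrictions of affine functions to a subset. -/
def affineRestrictions {d : ℕ} (K : Set (Fin d → ℝ)) : Submodule ℝ C(K, ℝ) where
  carrier := {u | ∃ A : (Fin d → ℝ) →ᵃ[ℝ] ℝ, ∀ x : K, u x = A x}
  zero_mem' := ⟨0, fun _ => rfl⟩
  add_mem' := by
    rintro u v ⟨A, hA⟩ ⟨B, hB⟩
    exact ⟨A + B, fun x => by simp [hA, hB]⟩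
  smul_mem' := by
    rintro r u ⟨A, hA⟩
    exact ⟨r • A, fun x => by simp [hA]⟩

theorem exists_mem_ridgeSpan_near {ρ : ℝ → ℝ} (hρ : Continuous ρ) (hpoly : ¬ IsPolynomialFun ρ)
    {d m : ℕ} {K : Set (Fin d → ℝ)} (hK : IsCompact K) {g : (Fin d → ℝ) → (Fin m → ℝ)}
    (hg : Continuous g) {δ : ℝ} (hδ : 0 < δ) :
    ∃ h ∈ ridgeSpan ρ d m, ∀ x ∈ K, ∀ j, |h x j - g x j| < δ := by
  have : CompactSpace K := isCompact_iff_compactSpace.1 hK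
  set S : Submodule ℝ C(K, ℝ) := Submodule.span ℝ
    {F | ∃ A : (Fin d → ℝ) →ᵃ[ℝ] ℝ, ∀ x : K, F x = ρ (A x)} with hS
  have htop : S.topologicalClosure = ⊤ := by
    refine eq_top_of_superpose_mem _ S.isClosed_topologicalClosure (affineRestrictions K)
      ⟨AffineMap.const ℝ _ 1, fun _ => rfl⟩ (fun x y hxy => ?_) hρ hpoly ?_
    · obtain ⟨i, hi⟩ := Function.ne_iff.1 (fun h => hxy (Subtype.ext h))
      exact ⟨⟨fun x => x.1 i, (continuous_apply i).comp continuous_subtype_val⟩, ⟨(LinearMap.proj i).toAffineMap, fun _ => rfl⟩, hi⟩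
    · rintro u ⟨A, hA⟩
      exact S.le_topologicalClosure (Submodule.subset_span ⟨A, fun x => by simp [hA]⟩)
  have hlift : ∀ F ∈ S, ∀ c : Fin m → ℝ, ∃ h ∈ ridgeSpan ρ d m, ∀ x : K, h x = F x • c := by
    intro F hF c
    induction hF using Submodule.span_induction with
    | mem F hF =>
      obtain ⟨A, hA⟩ := hF
      exact ⟨_, Submodule.subset_span ⟨A, c, rfl⟩, fun x => by simp [hA]⟩
    | zero => exact ⟨0, Submodule.zero_mem _, fun x => by simp⟩
    | add F G _ _ hF hG =>
      obtain ⟨f, hf, hf'⟩ := hF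
      obtain ⟨g, hg, hg'⟩ := hG
      exact ⟨f + g, Submodule.add_mem _ hf hg, fun x => by simp [hf', hg', add_smul]⟩
    | smul r F _ hF =>
      obtain ⟨f, hf, hf'⟩ := hF
      exact ⟨r • f, Submodule.smul_mem _ r hf, fun x => by simp [hf', mul_smul]⟩
  have happ : ∀ j : Fin m, ∃ F ∈ S, ∀ x : K, |F x - g x j| < δ := by
    intro j
    set G : C(K, ℝ) := ⟨fun x => g x j, by fun_prop⟩ with hG
    have hmem : G ∈ closure (S : Set C(K, ℝ)) := by
      have : G ∈ S.topologicalClosure := htop ▸ Submodule.mem_top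
      exact this
    obtain ⟨F, hF, hd⟩ := Metric.mem_closure_iff.1 hmem δ hδ
    refine ⟨F, hF, fun x => ?_⟩
    rw [abs_sub_comm]
    exact (ContinuousMap.dist_apply_le_dist (f := G) (g := F) x).trans_lt hd
  choose F hFS hF using happ
  choose h hh hhe using fun j => hlift (F j) (hFS j) (Pi.single j 1)
  refine ⟨∑ j, h j, Submodule.sum_mem _ fun j _ => hh j, fun x hx j => ?_⟩
  have : (∑ i, h i) x j = F j ⟨x, hx⟩ := by
    rw [Finset.sum_apply, Finset.sum_apply]
    have : ∀ i, h i x j = F i ⟨x, hx⟩ * (Pi.single i 1 : Fin m → ℝ) j := fun i => by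
      rw [hhe i ⟨x, hx⟩]; rfl
    simp [this, Pi.single_apply]
  rw [this]
  exact hF j ⟨x, hx⟩

theorem mem_shallowNetworks_of_mem_ridgeSpan {ρ : ℝ → ℝ} {d m : ℕ}
    {h : (Fin d → ℝ) → (Fin m → ℝ)} (hh : h ∈ ridgeSpan ρ d m) : h ∈ shallowNetworks ρ d m := by
  obtain ⟨n, A, c, rfl⟩ := exists_sum_of_mem_ridgeSpan hh
  refine ⟨n, AffineMap.pi A, _, ⟨(Fintype.linearCombination ℝ c).toAffineMap, rfl⟩, ?_⟩
  ext x j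
  simp [Fintype.linearCombination_apply]

theorem comp_affine_mem_neuralNetworks {ρ : ℝ → ℝ} {m N N' : ℕ} {Ns : List ℕ}
    {ψ : (Fin N → ℝ) → (Fin m → ℝ)} (hψ : ψ ∈ neuralNetworks ρ m N Ns)
    (A : (Fin N' → ℝ) →ᵃ[ℝ] (Fin N → ℝ)) : (fun x => ψ (A x)) ∈ neuralNetworks ρ m N' Ns := by
  cases Ns with
  | nil =>
    obtain ⟨W, rfl⟩ := hψ
    exact ⟨W.comp A, rfl⟩
  | cons M Ns =>
    obtain ⟨W, ψ, hψ, rfl⟩ := hψ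
    exact ⟨W.comp A, ψ, hψ, rfl⟩

/-! ### Deep networks of bounded width. -/

/-- A function with nonzero derivative at a point approximates the identity on bounded sets,
up to affine changes of variables. -/
theorem exists_affine_comp_near_id {ρ : ℝ → ℝ} {a ρ' : ℝ} (hρ : HasDerivAt ρ ρ' a) (h0 : ρ' ≠ 0)
    (R : ℝ) {δ : ℝ} (hδ : 0 < δ) :
    ∃ α β : ℝ →ᵃ[ℝ] ℝ, ∀ y, |y| ≤ R → |β (ρ (α y)) - y| < δ := by
  have hR : 0 < |R| + 1 := by positivity
  have hη : 0 < δ * |ρ'| / (|R| + 1) := by positivity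
  have ho := hρ.isLittleO.def (half_pos hη)
  obtain ⟨τ, hτ, hb⟩ := Metric.eventually_nhds_iff.1 ho
  -- This scale keeps `a + h * y` within `τ / 2` of `a` whenever `|y| ≤ R`.
  set h : ℝ := τ / (2 * (|R| + 1)) with hh
  have hhpos : 0 < h := by positivity
  refine ⟨AffineMap.lineMap a (a + h), (h * ρ')⁻¹ • (AffineMap.id ℝ ℝ - AffineMap.const ℝ ℝ (ρ a)),
    fun y hy => ?_⟩
  have hα : AffineMap.lineMap a (a + h) y = a + h * y := by
    simp [AffineMap.lineMap_apply]; ring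
  have hyR : |y| < |R| + 1 := by linarith [le_abs_self R]
  have hd : dist (a + h * y) a < τ := by
    rw [Real.dist_eq, add_sub_cancel_left, abs_mul, abs_of_pos hhpos]
    calc h * |y| ≤ h * (|R| + 1) := by gcongr
      _ = τ / 2 := by rw [hh]; field_simp
      _ < τ := half_lt_self hτ
  have hb' := hb hd
  rw [hα]
  have hval : ((h * ρ')⁻¹ • (AffineMap.id ℝ ℝ - AffineMap.const ℝ ℝ (ρ a))) (ρ (a + h * y)) - y
      = (ρ (a + h * y) - ρ a - (a + h * y - a) • ρ') / (h * ρ') := by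
    simp
    field_simp
  rw [hval, abs_div, div_lt_iff₀ (by positivity)]
  rw [Real.norm_eq_abs, Real.norm_eq_abs, add_sub_cancel_left] at hb'
  rw [add_sub_cancel_left]
  refine hb'.trans_lt ?_
  rw [abs_mul h y, abs_of_pos hhpos, abs_mul, abs_of_pos hhpos]
  calc δ * |ρ'| / (|R| + 1) / 2 * (h * |y|) ≤ δ * |ρ'| / (|R| + 1) / 2 * (h * (|R| + 1)) := by
        gcongr
    _ = δ * (h * |ρ'|) / 2 := by field_simp
    _ < δ * (h * |ρ'|) := half_lt_self (by positivity)

/-- `φ` is a limit, uniformly on compact sets, of networks with at least `k` hidden layers, all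
of size `w`. -/
def DeepApproximable (ρ : ℝ → ℝ) (w m k N : ℕ) (φ : (Fin N → ℝ) → (Fin m → ℝ)) : Prop :=
  ∀ C : Set (Fin N → ℝ), IsCompact C → ∀ δ > 0, ∃ n ≥ k,
    ∃ ψ ∈ neuralNetworks ρ m N (List.replicate n w), ∀ x ∈ C, dist (ψ x) (φ x) < δ

theorem DeepApproximable.of_affine (ρ : ℝ → ℝ) (w m : ℕ) {N : ℕ}
    (A : (Fin N → ℝ) →ᵃ[ℝ] (Fin m → ℝ)) : DeepApproximable ρ w m 0 N (fun x => A x) :=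
  fun _ _ δ hδ => ⟨0, le_rfl, _, ⟨A, rfl⟩, fun x _ => by simpa using hδ⟩

/-- Layers that apply `ρ` to the coordinates in `I` only can be realized approximately. -/
theorem DeepApproximable.comp_layer {ρ : ℝ → ℝ} (hρc : Continuous ρ) {a ρ' : ℝ}
    (hρ : HasDerivAt ρ ρ' a) (h0 : ρ' ≠ 0) {w m k N : ℕ} {φ : (Fin w → ℝ) → (Fin m → ℝ)}
    (hφ : DeepApproximable ρ w m k w φ) (hφc : Continuous φ)
    (A : Fin w → (Fin N → ℝ) →ᵃ[ℝ] ℝ) (I : Fin w → Bool) :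
    DeepApproximable ρ w m (k + 1) N
      (fun x => φ (fun i => if I i then ρ (A i x) else A i x)) := by
  intro C hC δ hδ
  set T : (Fin N → ℝ) → (Fin w → ℝ) := fun x i => if I i then ρ (A i x) else A i x with hT
  have hAc : ∀ i, Continuous (A i) := fun i => (A i).continuous_of_finiteDimensional
  have hTc : Continuous T := by
    refine continuous_pi fun i => ?_
    by_cases hi : I i
    · simpa [hT, hi, Function.comp_def] using hρc.comp (hAc i)
    · simpa [hT, hi] using hAc i
  -- The thickening leaves room for the error of the approximate layer: its output stays in a
  -- compact set on which `ψ` is close to `φ`.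
  set D := Metric.cthickening 1 (T '' C) with hD
  have hDc : IsCompact D := (hC.image hTc).cthickening
  obtain ⟨n, hn, ψ, hψ, hψφ⟩ := hφ D hDc (δ / 2) (half_pos hδ)
  obtain ⟨η, hη, hu⟩ := Metric.uniformContinuousOn_iff.1
    (hDc.uniformContinuousOn_of_continuous hφc.continuousOn) (δ / 2) (half_pos hδ)
  have hAcont : Continuous fun x => fun i => A i x := continuous_pi hAc
  obtain ⟨R, hR⟩ := hC.exists_bound_of_continuousOn hAcont.continuousOn
  obtain ⟨α, β, hαβ⟩ := exists_affine_comp_near_id hρ h0 R (lt_min hη one_pos)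
  set A' : (Fin N → ℝ) →ᵃ[ℝ] (Fin w → ℝ) :=
    AffineMap.pi fun i => if I i then A i else α.comp (A i) with hA'
  -- The outer correction `β` costs no layer: it merges into the next affine map.
  set B : (Fin w → ℝ) →ᵃ[ℝ] (Fin w → ℝ) := AffineMap.pi fun i =>
    if I i then (LinearMap.proj i).toAffineMap else β.comp (LinearMap.proj i).toAffineMap with hB
  refine ⟨n + 1, by omega, _, ⟨A', _, comp_affine_mem_neuralNetworks hψ B, rfl⟩, fun x hx => ?_⟩
  set y : Fin w → ℝ := B fun i => ρ (A' x i) with hy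
  have hyT : dist y (T x) < min η 1 := by
    refine (dist_pi_lt_iff (lt_min hη one_pos)).2 fun i => ?_
    by_cases hi : I i
    · simpa [hy, hB, hA', hT, hi] using hη
    · have := hαβ (A i x) ((norm_le_pi_norm (fun i => A i x) i).trans (hR x hx))
      simpa [hy, hB, hA', hT, hi, Real.dist_eq] using this
  have hTx : T x ∈ T '' C := ⟨x, hx, rfl⟩
  have hyD : y ∈ D := Metric.mem_cthickening_of_dist_le _ _ _ _ hTx
    (hyT.le.trans (min_le_right _ _))
  calc dist (ψ y) (φ (T x)) ≤ dist (ψ y) (φ y) + dist (φ y) (φ (T x)) := dist_triangle _ _ _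
    _ < δ / 2 + δ / 2 := add_lt_add (hψφ y hyD)
        (hu y hyD _ (Metric.self_subset_cthickening _ hTx) (hyT.trans_le (min_le_left _ _)))
    _ = δ := add_halves δ

theorem DeepApproximable.mono {ρ : ℝ → ℝ} {w m k k' N : ℕ} {φ : (Fin N → ℝ) → (Fin m → ℝ)}
    (hφ : DeepApproximable ρ w m k N φ) (hk : k' ≤ k) : DeepApproximable ρ w m k' N φ := by
  intro C hC δ hδ
  obtain ⟨n, hn, h⟩ := hφ C hC δ hδ
  exact ⟨n, hk.trans hn, h⟩

/-- The coordinates of a hidden layer: `d` registers that hold the input, `m` accumulators for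
the output, and two more neurons. -/
def registerEquiv (d m : ℕ) : (Fin d ⊕ Fin m) ⊕ Fin 2 ≃ Fin (d + m + 2) :=
  (finSumFinEquiv.sumCongr (Equiv.refl _)).trans finSumFinEquiv

/-- The function of a hidden layer that is left to be computed: `s` holds the input, a partial sum
and the next value of `ρ`, which enters with coefficient `c₀`. -/
def registerSum (ρ : ℝ → ℝ) {d m n : ℕ} (A : Fin n → (Fin d → ℝ) →ᵃ[ℝ] ℝ) (c : Fin n → Fin m → ℝ)
    (c₀ : Fin m → ℝ) (s : Fin (d + m + 2) → ℝ) : Fin m → ℝ := fun j =>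
  s (registerEquiv d m (.inl (.inr j))) + s (registerEquiv d m (.inr 0)) * c₀ j +
    ∑ i, ρ (A i fun l => s (registerEquiv d m (.inl (.inl l)))) * c i j

theorem continuous_registerSum {ρ : ℝ → ℝ} (hρ : Continuous ρ) {d m n : ℕ}
    (A : Fin n → (Fin d → ℝ) →ᵃ[ℝ] ℝ) (c : Fin n → Fin m → ℝ) (c₀ : Fin m → ℝ) :
    Continuous (registerSum ρ A c c₀) := by
  have := fun i => (A i).continuous_of_finiteDimensional
  unfold registerSum
  fun_prop

/-- Each layer adds the pending value, weighted by `c₀`, to the accumulators and computes the next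
ridge value; only the last two neurons apply `ρ` exactly. Both hold the same value and only the
first is read, the other being padding. -/
theorem deepApproximable_registerSum {ρ : ℝ → ℝ} (hρc : Continuous ρ) {a ρ' : ℝ}
    (hρ : HasDerivAt ρ ρ' a) (h0 : ρ' ≠ 0) {d m n : ℕ}
    (A : Fin n → (Fin d → ℝ) →ᵃ[ℝ] ℝ) (c : Fin n → Fin m → ℝ) (c₀ : Fin m → ℝ) :
    DeepApproximable ρ (d + m + 2) m 0 (d + m + 2) (registerSum ρ A c c₀) := by
  let pr : (Fin d ⊕ Fin m) ⊕ Fin 2 → (Fin (d + m + 2) → ℝ) →ₗ[ℝ] ℝ :=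
    fun i => LinearMap.proj (registerEquiv d m i)
  induction n generalizing c₀ with
  | zero =>
    convert DeepApproximable.of_affine ρ (d + m + 2) m
      (LinearMap.pi fun j => pr (.inl (.inr j)) + c₀ j • pr (.inr 0)).toAffineMap using 1
    ext s j
    simp [registerSum, pr, mul_comm]
  | succ n ih =>
    have := (ih (fun i => A i.succ) (fun i => c i.succ) (c 0)).comp_layer hρc hρ h0
      (continuous_registerSum hρc _ _ _)
      (fun i => Sum.elim (Sum.elim (fun l => (pr (.inl (.inl l))).toAffineMap)
        (fun j => (pr (.inl (.inr j)) + c₀ j • pr (.inr 0)).toAffineMap))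
        (fun _ => (A 0).comp (LinearMap.pi fun l => pr (.inl (.inl l))).toAffineMap)
        ((registerEquiv d m).symm i))
      (fun i => ((registerEquiv d m).symm i).isRight)
    convert this.mono (Nat.zero_le _) using 1
    ext s j
    simp only [registerSum, Equiv.symm_apply_apply, Sum.isRight, Sum.elim_inl, Sum.elim_inr,
      Fin.sum_univ_succ]
    simp [pr, mul_comm, add_assoc]
    exact Or.inl rfl

theorem deepApproximable_of_mem_ridgeSpan {ρ : ℝ → ℝ} (hρc : Continuous ρ) {a ρ' : ℝ}
    (hρ : HasDerivAt ρ ρ' a) (h0 : ρ' ≠ 0) {d m : ℕ}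
    {h : (Fin d → ℝ) → (Fin m → ℝ)} (hh : h ∈ ridgeSpan ρ d m) :
    DeepApproximable ρ (d + m + 2) m 1 d h := by
  obtain ⟨n, A, c, rfl⟩ := exists_sum_of_mem_ridgeSpan hh
  -- An initial layer loads the input and clears the other registers. It also guarantees a hidden
  -- layer, so that the width is attained.
  have := (deepApproximable_registerSum hρc hρ h0 A c 0).comp_layer hρc hρ h0
    (continuous_registerSum hρc _ _ _)
    (fun i => Sum.elim (Sum.elim (fun l => (LinearMap.proj l : (Fin d → ℝ) →ₗ[ℝ] ℝ).toAffineMap)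
      (fun _ => 0)) (fun _ => 0) ((registerEquiv d m).symm i)) (fun _ => false)
  convert this using 1
  ext x j
  simp [registerSum]

theorem exists_networksOfWidth_near {ρ : ℝ → ℝ} (hρc : Continuous ρ) {a ρ' : ℝ}
    (hρ : HasDerivAt ρ ρ' a) (h0 : ρ' ≠ 0) {d m : ℕ}
    {h : (Fin d → ℝ) → (Fin m → ℝ)} (hh : h ∈ ridgeSpan ρ d m)
    {K : Set (Fin d → ℝ)} (hK : IsCompact K) {δ : ℝ} (hδ : 0 < δ) :
    ∃ ψ ∈ networksOfWidth ρ d m (d + m + 2), ∀ x ∈ K, dist (ψ x) (h x) < δ := by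
  obtain ⟨n, hn, ψ, hψ, hd⟩ := deepApproximable_of_mem_ridgeSpan hρc hρ h0 hh K hK δ hδ
  refine ⟨ψ, ⟨_, ⟨?_, fun N hN => ?_⟩, hψ⟩, hd⟩
  · exact List.mem_replicate.2 ⟨by omega, rfl⟩
  · exact (List.mem_replicate.1 hN).2.le

/-! ### Scores, margins and the classification theorem. -/

theorem classPrediction_eq {n : ℕ} {v : Fin n → ℝ} {k : Fin n} (h : ∀ j ≠ k, v j < v k) :
    classPrediction v = k + 1 := by
  have : {i : ℕ | ∃ k : Fin n, i = (k : ℕ) + 1 ∧ ∀ j : Fin n, v j ≤ v k} = {(k : ℕ) + 1} := by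
    ext i
    constructor
    · rintro ⟨l, rfl, hl⟩
      by_cases hlk : l = k
      · rw [hlk]; rfl
      · exact absurd (hl k) (h l hlk).not_ge
    · rintro rfl
      refine ⟨k, rfl, fun j => ?_⟩
      by_cases hj : j = k
      · rw [hj]
      · exact (h j hj).le
  rw [classPrediction, this, csInf_singleton]

theorem exists_norm_toLp_le {d : ℕ} (p : ℝ≥0∞) (hp : 1 ≤ p) :
    ∃ C > 0, ∀ v : Fin d → ℝ, ‖WithLp.toLp p v‖ ≤ C * ‖v‖ := by
  have : Fact (1 ≤ p) := ⟨hp⟩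
  obtain ⟨C, hC, h⟩ := (PiLp.continuousLinearEquiv p ℝ
    (fun _ : Fin d => ℝ)).symm.toContinuousLinearMap.bound
  exact ⟨C, hC, h⟩

theorem boundaryDist_le {d : ℕ} {p : ℝ≥0∞} (hp : 1 ≤ p) {g : (Fin d → ℝ) → ℤ} {x z : Fin d → ℝ}
    (h : g x ≠ g z) : boundaryDist p g x ≤ ‖WithLp.toLp p (x - z)‖ := by
  have : Fact (1 ≤ p) := ⟨hp⟩
  refine csInf_le ⟨0, ?_⟩ ⟨z, h, rfl⟩
  rintro _ ⟨z, _, rfl⟩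
  exact norm_nonneg _

theorem labelExtension_mem {d : ℕ} {M : Set (Fin d → ℝ)} {Y : Finset ℤ} (f : M → Y)
    (x : Fin d → ℝ) : labelExtension f x ∈ extLabels Y := by
  unfold labelExtension extLabels
  split_ifs with hx
  · exact Finset.mem_insert_of_mem (f _).2
  · exact Finset.mem_insert_self _ _

theorem labelExtension_coe {d : ℕ} {M : Set (Fin d → ℝ)} {Y : Finset ℤ} (f : M → Y)
    (x : M) : labelExtension f x = f x := by
  simp [labelExtension]

/-- On the stable set, the labels are the strict maximizers of a continuous score function, with
a uniform margin. -/
theorem exists_score {d : ℕ} {p : ℝ≥0∞} (hp : 1 ≤ p) {M : Set (Fin d → ℝ)} {Y : Finset ℤ}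
    (f : M → Y) (hf : ∃ x y : M, f x ≠ f y) {q : ℕ} {σ : ℤ → ℕ}
    (hσ : Set.BijOn σ (extLabels Y : Set ℤ) (Set.Icc 1 q)) {ε : ℝ} (hε : 0 < ε) :
    ∃ g : (Fin d → ℝ) → (Fin q → ℝ), Continuous g ∧ ∃ δ > 0, ∀ x : M,
      (x : Fin d → ℝ) ∈ stableSet p f ε → ∃ k : Fin q, (k : ℕ) + 1 = σ (f x) ∧
        δ ≤ g x k ∧ ∀ j ≠ k, g x j = 0 := by
  obtain ⟨C, hC, hnorm⟩ := exists_norm_toLp_le (d := d) p hp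
  set T : Fin q → Set (Fin d → ℝ) := fun j => {z | σ (labelExtension f z) ≠ j + 1} with hT
  refine ⟨fun x j => Metric.infDist x (T j),
    -- `Metric.infDist` uses the sup norm, whence the division by the constant `C` comparing it with
    -- the `ℓ^p` norm.
    continuous_pi fun j => Metric.continuous_infDist_pt _, ε / C, by positivity, fun x hx => ?_⟩
  have hmem := hσ.mapsTo (labelExtension_mem f x)
  have hx1 : 1 ≤ σ (labelExtension f x) := hmem.1
  have hxq : σ (labelExtension f x) ≤ q := hmem.2
  refine ⟨⟨σ (labelExtension f x) - 1, by omega⟩, ?_, ?_, fun j hj => ?_⟩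
  · rw [← labelExtension_coe]
    dsimp only
    omega
  · refine (Metric.le_infDist ?_).2 fun z hz => ?_
    -- Non-constancy makes `T k` nonempty; the distance to the empty set would be `0` by convention.
    · obtain ⟨y, y', hne⟩ := hf
      by_contra hemp
      have hall : ∀ z, σ (labelExtension f z) = σ (labelExtension f x) := by
        intro z
        by_contra hz
        refine hemp ⟨z, fun h => hz (h.trans ?_)⟩
        dsimp only
        omega
      have := hσ.injOn (labelExtension_mem f y) (labelExtension_mem f y')
        ((hall y).trans (hall y').symm)
      rw [labelExtension_coe, labelExtension_coe] at this
      exact hne (Subtype.ext this)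
    · have hne : labelExtension f x ≠ labelExtension f z := by
        intro h
        apply hz
        rw [← h]
        dsimp only
        omega
      have h1 := hx.2.le.trans ((boundaryDist_le hp hne).trans (hnorm _))
      rw [dist_eq_norm, div_le_iff₀ hC]
      linarith
  · refine Metric.infDist_zero_of_mem fun h => hj (Fin.ext ?_)
    dsimp only
    omega

theorem theorem1 (d : ℕ) (p : ℝ≥0∞) (hp : 1 ≤ p)
    (M K : Set (Fin d → ℝ)) (hK : IsCompact K)
    (Y : Finset ℤ) (hY : ∀ y ∈ Y, 0 < y)
    (f : M → Y) (hf : ∃ x y : M, f x ≠ f y)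
    (q : ℕ) (hq : q = (extLabels Y).card)
    (σ : ℤ → ℕ) (hσ : Set.BijOn σ (extLabels Y : Set ℤ) (Set.Icc 1 q))
    (ε : ℝ) (hε : 0 < ε)
    (ρ : ℝ → ℝ) (hρ : Continuous ρ) (hρ_poly : ¬ IsPolynomialFun ρ)
    (hρ_diff : ∃ a : ℝ, ContinuouslyDifferentiableAt ρ a ∧ deriv ρ a ≠ 0) :
    (∃ Ψ₁ ∈ shallowNetworks ρ d q,
      ∀ x : M, (x : Fin d → ℝ) ∈ stableSet p f ε ∩ K → classPrediction (Ψ₁ x) = σ (f x)) ∧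
    (∃ Ψ₂ ∈ networksOfWidth ρ d q (d + q + 2),
      ∀ x : M, (x : Fin d → ℝ) ∈ stableSet p f ε ∩ K → classPrediction (Ψ₂ x) = σ (f x)) := by
  obtain ⟨g, hg, δ, hδ, hscore⟩ := exists_score hp f hf hσ hε
  obtain ⟨a, hdiff, h0⟩ := hρ_diff
  have hda : HasDerivAt ρ (deriv ρ a) a := hdiff.1.self_of_nhds.hasDerivAt
  -- With error below `δ / 2`, wrong coordinates stay below `δ / 2` and the right one above it.
  have key : ∀ ψ : (Fin d → ℝ) → (Fin q → ℝ), (∀ x ∈ K, ∀ j, |ψ x j - g x j| < δ / 2) →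
      ∀ x : M, (x : Fin d → ℝ) ∈ stableSet p f ε ∩ K → classPrediction (ψ x) = σ (f x) := by
    intro ψ hψ x hx
    obtain ⟨k, hk, hgk, hgj⟩ := hscore x hx.1
    rw [← hk]
    refine classPrediction_eq fun j hj => ?_
    have h1 := abs_lt.1 (hψ x hx.2 j)
    have h2 := abs_lt.1 (hψ x hx.2 k)
    rw [hgj j hj] at h1
    linarith [h1.2, h2.1]
  obtain ⟨h, hh, hhg⟩ := exists_mem_ridgeSpan_near hρ hρ_poly hK hg (δ := δ / 4) (by positivity)
  obtain ⟨ψ, hψ, hψh⟩ := exists_networksOfWidth_near hρ hda h0 hh hK (δ := δ / 4) (by positivity)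
  refine ⟨⟨h, mem_shallowNetworks_of_mem_ridgeSpan hh,
    key h fun x hx j => (hhg x hx j).trans (by linarith)⟩, ψ, hψ, key ψ fun x hx j => ?_⟩
  have h1 := (dist_le_pi_dist (ψ x) (h x) j).trans_lt (hψh x hx)
  rw [Real.dist_eq] at h1
  calc |ψ x j - g x j| ≤ |ψ x j - h x j| + |h x j - g x j| := abs_sub_le _ _ _
    _ < δ / 4 + δ / 4 := add_lt_add h1 (hhg x hx j)
    _ = δ / 2 := by ring
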